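/- A \emph{countable stochastic game} $\mathcal G$ consists of a countable set $S$ of states, partitioned into the states $S_\Box$ of the maximizer, the states $S_\Diamond$ of the minimizer and the random states $S_\bigcirc$; a transition relation ${\longrightarrow}\subseteq S\times S$ such that every state has at least one successor; and, for every $s\in S_\bigcirc$, a probability distribution $P(s)$ over the successors of $s$. The game is \emph{finitely branching} if every state has only finitely many successors. A \emph{strategy} of the maximizer (resp. minimizer) assigns to every finite sequence of states $ws$ with $s\in S_\Box$ (resp. $s\in S_\Diamond$) a probability distribution over the successors of $s$; let $\Sigma$ (resp. $\Pi$) be the set of all strategies of the maximizer (resp. minimizer). A strategy is \emph{memoryless deterministic} (MD) if it is given by a function that maps each state $s$ of the player to a single successor of $s$, which is chosen with probability $1$ after every sequence $ws$. An initial state $s$ and strategies $\sigma\in\Sigma$, $\pi\in\Pi$ induce in the usual way a probability measure $\mathcal P_{\mathcal G,s,\sigma,\pi}$ on the set $S^\omega$ of infinite sequences of states. For $T\subseteq S$ let $\mathrm{B\ddot uchi}(T)=\{s_0s_1\cdots\in S^\omega \mid \forall i\,\exists j\ge i:\ s_j\in T\}$. \textbf{Theorem.} Let $\mathcal G$ be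 a finitely branching countable stochastic game and let $T\subseteq S$. Then there exist an MD strategy $\hat\sigma$ of the maximizer and an MD strategy $\hat\pi$ of the minimizer such that for all states $s\in S$: \[ \forall\,\pi\in\Pi:\ \mathcal P_{\mathcal G,s,\hat\sigma,\pi}(\mathrm{B\ddot uchi}(T))=1 \quad\text{or}\quad \forall\,\sigma\in\Sigma:\ \mathcal P_{\mathcal G,s,\sigma,\hat\pi}(\mathrm{B\ddot uchi}(T))<1 . \] Hence finitely branching almost-sure Büchi games are strongly MD-determined: for every state $s$, either there is an MD strategy $\sigma$ of the maximizer such that $\mathcal P_{\mathcal G,s,\sigma,\pi}(\mathrm{B\ddot uchi}(T))\ge 1$ for all $\pi\in\Pi$, or there is an MD strategy $\pi$ of the minimizer such that $\mathcal P_{\mathcal G,s,\sigma,\pi}(\mathrm{B\ddot uchi}(T))<1$ for all $\sigma\in\Sigma$. -/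

import Mathlib

open MeasureTheory ProbabilityTheory
open scoped ENNReal

/-- The two players: `max` is the maximizer (box), `min` is the minimizer (diamond). -/
inductive Player where
  | max
  | min

/-- A turn-based stochastic game (2½-player game) with state space `S`.
`owner s = some p` means that `s` belongs to player `p`, and `owner s = none` means that `s` is a
random state, so that `S` is partitioned into three sets (each possibly empty). -/
structure StochasticGame (S : Type*) where
  /-- Who owns a state (`none`: random). -/
  owner : S → Option Player
  /-- The transition relation. -/
  trans : S → S → Prop
  /-- Every state has a successor. -/
  exists_succ : ∀ s, ∃ s', trans s s'
  /-- The probability distribution of a random state. -/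
  prob : ∀ s, owner s = none → PMF S
  /-- It is a distribution over the successors of that state. -/
  prob_support : ∀ s (h : owner s = none), (prob s h).support ⊆ {s' | trans s s'}

namespace StochasticGame

variable {S : Type*}

/-- Each state has only finitely many successors. -/
def FinitelyBranching (G : StochasticGame S) : Prop :=
  ∀ s, {s' | G.trans s s'}.Finite

/-- A (history-dependent, randomized) strategy of player `p`: to a finite sequence `w` of states
followed by a state `s` owned by `p`, i.e. to `ws`, it assigns a distribution over the
successors of `s`. -/
structure Strategy (G : StochasticGame S) (p : Player) where
  /-- The distribution chosen after the history `ws`. -/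
  move : ∀ (_w : List S) (s : S), G.owner s = some p → PMF S
  /-- Only successors are chosen. -/
  move_support : ∀ w s (h : G.owner s = some p), (move w s h).support ⊆ {s' | G.trans s s'}

/-- A strategy is memoryless deterministic (MD) if it is given by a function that maps each state
of the player to a single next state, regardless of the history. -/
def Strategy.IsMD {G : StochasticGame S} {p : Player} (τ : G.Strategy p) : Prop :=
  ∃ f : ∀ s, G.owner s = some p → S, ∀ w s (h : G.owner s = some p), τ.move w s h = PMF.pure (f s h)

/-- The distribution of the next state after the history `ws`, given the strategies of the
two players. -/
def step (G : StochasticGame S) (σ : G.Strategy .max) (π : G.Strategy .min)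
    (w : List S) (s : S) : PMF S :=
  match h : G.owner s with
  | some .max => σ.move w s h
  | some .min => π.move w s h
  | none => G.prob s h

section Measure

/-! The countable set `S` carries the discrete σ-algebra, so the product σ-algebra on `ℕ → S` is
the one generated by the cylinder sets. -/

variable [Countable S] [MeasurableSpace S] [DiscreteMeasurableSpace S]

/-- The transition kernel from the first `n + 1` states `x 0, …, x n` of a play to the next one. -/
noncomputable def stepKernel (G : StochasticGame S) (σ : G.Strategy .max) (π : G.Strategy .min)
    (n : ℕ) : Kernel (Finset.Iic n → S) S :=
  Kernel.ofFunOfCountable fun x =>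
    (G.step σ π (List.ofFn fun i : Fin n => x ⟨i, Finset.mem_Iic.2 i.isLt.le⟩)
      (x ⟨n, Finset.mem_Iic.2 le_rfl⟩)).toMeasure

instance (G : StochasticGame S) (σ : G.Strategy .max) (π : G.Strategy .min) (n : ℕ) :
    IsMarkovKernel (G.stepKernel σ π n) :=
  ⟨fun _ => PMF.toMeasure.isProbabilityMeasure _⟩

/-- The probability measure on infinite sequences of states that is induced by the initial state
`s` and the strategies `σ` and `π` (constructed with the Ionescu-Tulcea theorem). -/
noncomputable def playMeasure (G : StochasticGame S) (s : S) (σ : G.Strategy .max)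
    (π : G.Strategy .min) : Measure (ℕ → S) :=
  Kernel.traj (X := fun _ => S) (G.stepKernel σ π) 0 fun _ => s

/-- The game with the threshold objective `(E, ▷ c)` is strongly MD-determined: in every state one
of the two players has an MD strategy that is winning from this state. -/
def StronglyMDDetermined (G : StochasticGame S) (E : Set (ℕ → S)) (rel : ℝ≥0∞ → ℝ≥0∞ → Prop)
    (c : ℝ≥0∞) : Prop :=
  ∀ s : S,
    (∃ σ : G.Strategy .max, σ.IsMD ∧ ∀ π : G.Strategy .min, rel (G.playMeasure s σ π E) c) ∨
    (∃ π : G.Strategy .min, π.IsMD ∧ ∀ σ : G.Strategy .max, ¬ rel (G.playMeasure s σ π E) c)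

end Measure

end StochasticGame

/-- The Büchi objective: the sequences of states that visit `T` infinitely often. -/
def buchi {S : Type*} (T : Set S) : Set (ℕ → S) :=
  {w | ∀ i, ∃ j ≥ i, w j ∈ T}

/-! The value of a reachability game is the least solution of the Bellman equations. If its values
are bounded below by a positive constant, then they are all `1`.

*Reachability.* If all values are `1`, the maximizer has a single memoryless deterministic strategy
that reaches the target almost surely from everywhere. Near-optimal choices achieve the value `2/3`
in a given state; making them compulsory where they achieve at least `1/3` costs at most the factor
`1/3` of the values, hence nothing by the zero-one law, and whatever the maximizer does afterwards,
the given state keeps the value `1/3`. Doing this for one state after the other fixes a strategy all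
of whose values are at least `1/3`, hence `1`.

*Büchi.* Take a maximal set `L` of states that a partial memoryless deterministic strategy of the
minimizer spoils, and let `u s` be the value of reaching `T` from `s` without visiting `L`. If the
objective holds almost surely, then the play almost surely avoids `L`; so, by minimizing `u`, the
minimizer also spoils the states from which one step yields an expectation of `u` below `1`. As `L`
is maximal, there are none outside `L`. Hence the maximizer can stay outside `L`, and by the first
part can do so while reaching `T` almost surely from everywhere, that is, again and again.
-/

namespace StochasticGame

section Transformers

variable {S : Type*} {B B' : (S → ℝ≥0∞) →o (S → ℝ≥0∞)} {X : Set S} {s : S} {f : S → ℝ≥0∞}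
  {l : ℝ≥0∞}

/-- A monotone transformer of functions on the states is *affine* if it is compatible with the
maps `x ↦ a + b * x`, where `b` is positive and finite. This is all that is used of the
expectation of a function after one step, maximized or minimized over some choices. -/
structure IsAffine (B : (S → ℝ≥0∞) →o (S → ℝ≥0∞)) : Prop where
  map_zero : B 0 = 0
  map_const_add (a : ℝ≥0∞) (f : S → ℝ≥0∞) (s : S) : B (fun t => a + f t) s = a + B f s
  map_const_mul {b : ℝ≥0∞} (h0 : b ≠ 0) (htop : b ≠ ∞) (f : S → ℝ≥0∞) (s : S) :
    B (fun t => b * f t) s = b * B f s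

theorem IsAffine.map_one (hB : IsAffine B) : B 1 = 1 := by
  funext s
  calc B 1 s = B (fun t => 1 + (0 : S → ℝ≥0∞) t) s := by simp only [Pi.zero_apply, add_zero]; rfl
    _ = 1 := by rw [hB.map_const_add, hB.map_zero, Pi.zero_apply, add_zero]

open Classical in
/-- The transformer `B`, with the value `1` prescribed on `X`. -/
noncomputable def reachStep (B : (S → ℝ≥0∞) →o (S → ℝ≥0∞)) (X : Set S) :
    (S → ℝ≥0∞) →o (S → ℝ≥0∞) where
  toFun f := X.piecewise 1 (B f)
  monotone' _ _ hfg := Set.piecewise_mono (fun _ _ => le_rfl) fun s _ => B.monotone hfg s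

theorem reachStep_of_mem (hs : s ∈ X) : reachStep B X f s = 1 := by
  classical exact X.piecewise_eq_of_mem _ _ hs

theorem reachStep_of_notMem (hs : s ∉ X) : reachStep B X f s = B f s := by
  classical exact X.piecewise_eq_of_notMem _ _ hs

/-- The value of the game of reaching `X`, when `B` is the value of a single step: the least
function that is `1` on `X` and a fixed point of `B` elsewhere. -/
noncomputable def reachValue (B : (S → ℝ≥0∞) →o (S → ℝ≥0∞)) (X : Set S) : S → ℝ≥0∞ :=
  (reachStep B X).lfp

theorem reachValue_of_mem (hs : s ∈ X) : reachValue B X s = 1 := by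
  rw [reachValue, ← OrderHom.map_lfp, reachStep_of_mem hs]

theorem reachValue_of_notMem (hs : s ∉ X) : reachValue B X s = B (reachValue B X) s := by
  conv_lhs => rw [reachValue, ← OrderHom.map_lfp, reachStep_of_notMem hs, ← reachValue]

/-- The minimum of `f` and the value is a supersolution, so that `f` itself need not be one where
the claim is known already. -/
theorem reachValue_le (hX : ∀ s ∈ X, 1 ≤ f s)
    (h : ∀ s ∉ X, reachValue B X s ≤ f s ∨ B f s ≤ f s) : reachValue B X ≤ f := by
  have hsuper : reachStep B X (reachValue B X ⊓ f) ≤ reachValue B X ⊓ f := by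
    intro s
    by_cases hs : s ∈ X
    · rw [reachStep_of_mem hs]
      exact le_inf (reachValue_of_mem hs).ge (hX s hs)
    · have hle : B (reachValue B X ⊓ f) s ≤ reachValue B X s :=
        (B.monotone inf_le_left s).trans (reachValue_of_notMem hs).ge
      have hle' : B (reachValue B X ⊓ f) s ≤ f s :=
        (h s hs).elim hle.trans (B.monotone inf_le_right s).trans
      rw [reachStep_of_notMem hs]
      exact le_inf hle hle'
  exact (OrderHom.lfp_le _ hsuper).trans inf_le_right

theorem reachValue_mono (h : B ≤ B') : reachValue B X ≤ reachValue B' X :=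
  reachValue_le (fun _ hs => (reachValue_of_mem hs).ge) fun s hs =>
    .inr ((h _ s).trans (reachValue_of_notMem hs).ge)

theorem reachValue_le_one (hB : B 1 ≤ 1) : reachValue B X ≤ 1 :=
  reachValue_le (fun _ _ => le_rfl) fun s _ => .inr (hB s)

theorem IsAffine.reachValue_le_one (hB : IsAffine B) : reachValue B X ≤ 1 :=
  StochasticGame.reachValue_le_one hB.map_one.le

/-- A zero-one law: if the values are at least `c`, then replacing each value `x` by
`(x - c) / (1 - c)` gives a supersolution again, so that the values are all `1`. -/
theorem IsAffine.reachValue_eq_one (hB : IsAffine B) {c : ℝ≥0∞} (hc : c ≠ 0)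
    (h : ∀ s, c ≤ reachValue B X s) : reachValue B X = 1 := by
  wlog hc1 : c < 1 generalizing c
  · refine this (c := 2⁻¹) (by simp) (fun s => ?_) ENNReal.one_half_lt_one
    exact (ENNReal.one_half_lt_one.le.trans (not_lt.1 hc1)).trans (h s)
  set u := reachValue B X with hu
  have hd : 1 - c ≠ 0 := (tsub_pos_of_lt hc1).ne'
  have hd' : 1 - c ≠ ∞ := ENNReal.sub_ne_top ENNReal.one_ne_top
  set v : S → ℝ≥0∞ := fun s => (1 - c)⁻¹ * (u s - c)
  have hv : ∀ s, c + (1 - c) * v s = u s := fun s => by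
    rw [ENNReal.mul_inv_cancel_left hd hd', add_tsub_cancel_of_le (h s)]
  have huv : u ≤ v := by
    refine reachValue_le (fun s hs => ?_) fun s hs => .inr (le_of_eq ?_)
    · simp [v, hu ▸ reachValue_of_mem hs, ENNReal.inv_mul_cancel hd hd']
    · have huv' : c + (1 - c) * B v s = c + (1 - c) * v s := by
        rw [hv, hu, reachValue_of_notMem hs, ← hB.map_const_mul hd hd', ← hB.map_const_add]
        simp only [hv]; rfl
      exact (ENNReal.mul_right_inj hd hd').1 ((ENNReal.add_right_inj hc1.ne_top).1 huv')
  refine le_antisymm hB.reachValue_le_one fun s => ?_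
  have hus : u s ≤ 1 := hB.reachValue_le_one s
  have key : c * 1 + (1 - c) * u s ≤ c * u s + (1 - c) * u s := by
    calc c * 1 + (1 - c) * u s ≤ c + (1 - c) * v s := by
          rw [mul_one]; gcongr; exact huv s
      _ = c * u s + (1 - c) * u s := by
          rw [hv, ← add_mul, add_tsub_cancel_of_le hc1.le, one_mul]
  have hfin : (1 - c) * u s ≠ ∞ :=
    ENNReal.mul_ne_top hd' (ne_top_of_le_ne_top ENNReal.one_ne_top hus)
  exact (ENNReal.mul_le_mul_iff_right hc hc1.ne_top).1 ((ENNReal.add_le_add_iff_right hfin).1 key)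

/-- Steps of the transformer `discount l B` are discounted by the factor `l`. -/
noncomputable def discount (l : ℝ≥0∞) (B : (S → ℝ≥0∞) →o (S → ℝ≥0∞)) :
    (S → ℝ≥0∞) →o (S → ℝ≥0∞) where
  toFun f s := l * B f s
  monotone' _ _ hfg s := mul_le_mul_right (B.monotone hfg s) l

theorem discount_apply : discount l B f s = l * B f s := rfl

/-- Each step multiplies the greatest excess of `f` over the value by a factor of at most `l`. -/
theorem IsAffine.le_reachValue_of_le_discount (hB : IsAffine B) (hl : l < 1) (hf : f ≤ 1)
    (h : ∀ s ∉ X, f s ≤ discount l B f s) : f ≤ reachValue B X := by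
  set u := reachValue B X
  set d := ⨆ s, (f s - u s)
  have hfd : ∀ s, f s ≤ d + u s := fun s =>
    tsub_le_iff_right.1 (le_iSup (fun s => f s - u s) s)
  have hd1 : d ≤ 1 := iSup_le fun s => tsub_le_self.trans (hf s)
  have hd : d ≤ l * d := iSup_le fun s => by
    rw [tsub_le_iff_right]
    by_cases hs : s ∈ X
    · exact ((hf s).trans (reachValue_of_mem hs).ge).trans le_add_self
    · calc f s ≤ l * B f s := h s hs
        _ ≤ l * B (fun t => d + u t) s := by gcongr; exact B.monotone hfd s
        _ = l * d + l * u s := by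
          rw [hB.map_const_add, mul_add, ← reachValue_of_notMem hs]
        _ ≤ l * d + u s := by gcongr; exact mul_le_of_le_one_left' hl.le
  have hd0 : d = 0 := by
    by_contra hd0
    exact hd.not_gt ((ENNReal.mul_lt_mul_left hd0 (ne_top_of_le_ne_top ENNReal.one_ne_top hd1)
      hl).trans_eq (one_mul d))
  exact fun s => (hfd s).trans_eq (by rw [hd0, zero_add])

/-- A transformer is *ω-continuous* if it commutes with suprema of increasing sequences; only the
inequality that is not automatic is required. -/
def IsOmegaContinuous (B : (S → ℝ≥0∞) →o (S → ℝ≥0∞)) : Prop :=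
  ∀ f : ℕ → S → ℝ≥0∞, Monotone f → B (⨆ n, f n) ≤ ⨆ n, B (f n)

theorem IsOmegaContinuous.reachValue_le_iSup_discount (hB : IsOmegaContinuous B)
    {k : ℕ → ℝ≥0∞} (hk : Monotone k) (hk1 : ⨆ n, k n = 1) :
    reachValue B X ≤ ⨆ n, reachValue (discount (k n) B) X := by
  have hmono : Monotone fun n => reachValue (discount (k n) B) X := fun m n hmn =>
    reachValue_mono fun f s => mul_le_mul_left (hk hmn) _
  refine reachValue_le (fun s hs => ?_) fun s hs => .inr ?_
  · exact (le_iSup_of_le (f := fun n => reachValue (discount (k n) B) X s) 0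
      (reachValue_of_mem hs).ge).trans_eq iSup_apply.symm
  · calc B (⨆ n, reachValue (discount (k n) B) X) s
        ≤ (⨆ n, k n) * ⨆ n, B (reachValue (discount (k n) B) X) s := by
          rw [hk1, one_mul]; simpa using hB _ hmono s
      _ ≤ ⨆ n, k n * B (reachValue (discount (k n) B) X) s := by
          rw [ENNReal.iSup_mul]
          refine iSup_le fun m => ?_
          rw [ENNReal.mul_iSup]
          refine iSup_le fun n => ?_
          refine le_iSup_of_le (max m n) ?_
          gcongr
          exacts [hk (le_max_left m n), B.monotone (hmono (le_max_right m n)) s]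
      _ = (⨆ n, reachValue (discount (k n) B) X) s := by
          rw [iSup_apply]
          exact iSup_congr fun n => (reachValue_of_notMem (B := discount (k n) B) hs).symm

theorem IsOmegaContinuous.exists_lt_reachValue_discount (hB : IsOmegaContinuous B) {c : ℝ≥0∞}
    (hc : c < reachValue B X s) : ∃ k < 1, c < reachValue (discount k B) X s := by
  obtain ⟨k, hk, hk1, hlim⟩ := exists_seq_strictMono_tendsto' (zero_lt_one (α := ℝ≥0∞))
  have hle := hB.reachValue_le_iSup_discount (X := X) hk.monotone
    (iSup_eq_of_tendsto hk.monotone hlim) s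
  rw [iSup_apply] at hle
  obtain ⟨n, hn⟩ := lt_iSup_iff.1 (hc.trans_le hle)
  exact ⟨k n, (hk1 n).2, hn⟩

end Transformers

section Bellman

variable {S : Type*} {C C' : S → Set S} {M M' : (S → ℝ≥0∞) →o (S → ℝ≥0∞)} {f : S → ℝ≥0∞}
  {s t : S}

/-- The best value of a function over the states in `C s`. -/
noncomputable def supOver (C : S → Set S) : (S → ℝ≥0∞) →o (S → ℝ≥0∞) where
  toFun f s := ⨆ t : C s, f t
  monotone' _ _ hfg _ := iSup_mono fun t => hfg t

/-- The worst value of a function over the states in `C s`. -/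
noncomputable def infOver (C : S → Set S) : (S → ℝ≥0∞) →o (S → ℝ≥0∞) where
  toFun f s := ⨅ t : C s, f t
  monotone' _ _ hfg _ := iInf_mono fun t => hfg t

theorem le_supOver (ht : t ∈ C s) : f t ≤ supOver C f s :=
  le_iSup (fun t : C s => f t) ⟨t, ht⟩

theorem supOver_le {a : ℝ≥0∞} (h : ∀ t ∈ C s, f t ≤ a) : supOver C f s ≤ a :=
  iSup_le fun t => h t t.2

theorem infOver_le (ht : t ∈ C s) : infOver C f s ≤ f t :=
  iInf_le (fun t : C s => f t) ⟨t, ht⟩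

theorem le_infOver {a : ℝ≥0∞} (h : ∀ t ∈ C s, a ≤ f t) : a ≤ infOver C f s :=
  le_iInf fun t => h t t.2

theorem supOver_mono (h : ∀ s, C s ⊆ C' s) : supOver C ≤ supOver C' := fun _ s =>
  supOver_le fun _ ht => le_supOver (h s ht)

theorem isAffine_supOver (hC : ∀ s, (C s).Nonempty) : IsAffine (supOver C) where
  map_zero := funext fun _ => le_antisymm (supOver_le fun _ _ => le_rfl) bot_le
  map_const_add a f s := by
    have := (hC s).to_subtype
    exact (ENNReal.add_iSup _).symm
  map_const_mul _ _ f s := (ENNReal.mul_iSup _ _).symm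

theorem isAffine_infOver (hC : ∀ s, (C s).Nonempty) : IsAffine (infOver C) where
  map_zero := funext fun s =>
    le_antisymm ((infOver_le (f := 0) (hC s).some_mem).trans_eq rfl) bot_le
  map_const_add _ _ _ := ENNReal.add_iInf.symm
  map_const_mul h0 htop _ _ := (ENNReal.mul_iInf_of_ne h0 htop).symm

theorem isOmegaContinuous_supOver : IsOmegaContinuous (supOver C) := fun f _ s => by
  refine supOver_le fun t ht => ?_
  simp only [iSup_apply]
  exact iSup_mono fun n => le_supOver ht

theorem exists_mem_mul_supOver_le (hC : (C s).Nonempty) {l : ℝ≥0∞} (hl : l < 1) (hf : f ≤ 1) :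
    ∃ t ∈ C s, l * supOver C f s ≤ f t := by
  rcases eq_or_ne (supOver C f s) 0 with h0 | h0
  · exact ⟨_, hC.some_mem, by simp [h0]⟩
  · have hlt : l * supOver C f s < supOver C f s :=
      (ENNReal.mul_lt_mul_left h0 (ne_top_of_le_ne_top ENNReal.one_ne_top
        (supOver_le fun t _ => hf t)) hl).trans_eq (one_mul _)
    obtain ⟨t, ht⟩ := lt_iSup_iff.1 hlt
    exact ⟨t, t.2, ht.le⟩

/-- The successors of a state. -/
def succs (G : StochasticGame S) (s : S) : Set S :=
  {t | G.trans s t}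

theorem succs_nonempty (G : StochasticGame S) (s : S) : (G.succs s).Nonempty :=
  G.exists_succ s

theorem exists_le_infOver_succs {G : StochasticGame S}
    (hG : ∀ s, G.owner s = some .min → (G.succs s).Finite) (u : S → ℝ≥0∞) :
    ∃ f : S → S, (∀ s, f s ∈ G.succs s) ∧
      ∀ s, G.owner s = some .min → u (f s) ≤ infOver G.succs u s := by
  have hex : ∀ s, ∃ t ∈ G.succs s, G.owner s = some .min → u t ≤ infOver G.succs u s := fun s => by
    by_cases hs : G.owner s = some .min
    · obtain ⟨t, ht, hmin⟩ := (G.succs s).exists_min_image u (hG s hs) (G.succs_nonempty s)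
      exact ⟨t, ht, fun _ => le_infOver hmin⟩
    · exact ⟨_, (G.succs_nonempty s).some_mem, fun h => absurd h hs⟩
  choose f hf hmin using hex
  exact ⟨f, hf, hmin⟩

variable [MeasurableSpace S] {G : StochasticGame S}

/-- The expectation of a function after one step: `M` stands for the choice of the maximizer, and
the minimizer plays optimally. -/
noncomputable def bellman (G : StochasticGame S) (M : (S → ℝ≥0∞) →o (S → ℝ≥0∞)) :
    (S → ℝ≥0∞) →o (S → ℝ≥0∞) where
  toFun f s :=
    match h : G.owner s with
    | some .max => M f s
    | some .min => infOver G.succs f s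
    | none => ∫⁻ t, f t ∂(G.prob s h).toMeasure
  monotone' f g hfg s := by
    dsimp only
    split
    exacts [M.monotone hfg s, (infOver _).monotone hfg s, lintegral_mono hfg]

theorem bellman_max (h : G.owner s = some .max) : bellman G M f s = M f s := by
  simp only [bellman, ← OrderHom.toFun_eq_coe]
  split <;> simp_all

theorem bellman_min (h : G.owner s = some .min) : bellman G M f s = infOver G.succs f s := by
  simp only [bellman, ← OrderHom.toFun_eq_coe]
  split <;> simp_all

theorem bellman_random (h : G.owner s = none) :
    bellman G M f s = ∫⁻ t, f t ∂(G.prob s h).toMeasure := by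
  simp only [bellman, ← OrderHom.toFun_eq_coe]
  split <;> simp_all

theorem mul_bellman_le {l : ℝ≥0∞} (hl : l ≤ 1) (h : l * M f s ≤ M' f s) :
    l * bellman G M f s ≤ bellman G M' f s := by
  rcases hs : G.owner s with _ | _ | _
  · simpa only [bellman_random hs] using mul_le_of_le_one_left' hl
  · simpa only [bellman_max hs] using h
  · simpa only [bellman_min hs] using mul_le_of_le_one_left' hl

theorem bellman_le_bellman (h : M f s ≤ M' f s) : bellman G M f s ≤ bellman G M' f s := by
  simpa only [one_mul] using mul_bellman_le le_rfl ((one_mul _).trans_le h)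

theorem bellman_mono (h : M ≤ M') : bellman G M ≤ bellman G M' := fun f s =>
  bellman_le_bellman (h f s)

theorem isAffine_bellman (hM : IsAffine M) : IsAffine (bellman G M) where
  map_zero := by
    funext s
    rcases hs : G.owner s with _ | _ | _
    · simp [bellman_random hs]
    · rw [bellman_max hs, hM.map_zero]
    · rw [bellman_min hs, (isAffine_infOver G.succs_nonempty).map_zero]
  map_const_add a f s := by
    rcases hs : G.owner s with _ | _ | _
    · simp [bellman_random hs, lintegral_add_left measurable_const]
    · simp only [bellman_max hs, hM.map_const_add]
    · simp only [bellman_min hs, (isAffine_infOver G.succs_nonempty).map_const_add]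
  map_const_mul h0 htop f s := by
    rcases hs : G.owner s with _ | _ | _
    · simp only [bellman_random hs, lintegral_const_mul' _ _ htop]
    · simp only [bellman_max hs, hM.map_const_mul h0 htop]
    · simp only [bellman_min hs, (isAffine_infOver G.succs_nonempty).map_const_mul h0 htop]

theorem isOmegaContinuous_bellman [DiscreteMeasurableSpace S]
    (hG : ∀ s, G.owner s = some .min → (G.succs s).Finite)
    (hM : IsOmegaContinuous M) : IsOmegaContinuous (bellman G M) := fun f hf s => by
  rw [iSup_apply]
  rcases hs : G.owner s with _ | _ | _
  · simp only [bellman_random hs, iSup_apply]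
    exact (lintegral_iSup (fun _ => .of_discrete) hf).le
  · simpa only [bellman_max hs, iSup_apply] using hM f hf s
  · have := (hG s hs).to_subtype
    simp only [bellman_min hs]
    calc infOver G.succs (⨆ n, f n) s = ⨅ t : G.succs s, ⨆ n, f n t :=
          iInf_congr fun t => iSup_apply
      _ ≤ ⨆ n, infOver G.succs (f n) s :=
          (iSup_iInf_of_monotone fun (t : G.succs s) _ _ hmn => hf hmn t).ge

end Bellman

section Selection

variable {S : Type*} [MeasurableSpace S] {G : StochasticGame S} {X : Set S} {C : S → Set S}
  {g : S → S} {c : ℝ≥0∞} {s : S}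

/-- The restriction `C` of the choices of the maximizer leaves some choice in each state, and does
not keep the maximizer from reaching `X` with probabilities arbitrarily close to `1`. -/
structure IsWinningRestriction (G : StochasticGame S) (X : Set S) (C : S → Set S) : Prop where
  nonempty (s : S) : (C s).Nonempty
  reachValue_eq_one : reachValue (bellman G (supOver C)) X = 1

open Classical in
/-- The restriction `C`, with the selection `g` made compulsory where it achieves the value `c`. -/
noncomputable def commit (G : StochasticGame S) (X : Set S) (C : S → Set S) (g : S → S)
    (c : ℝ≥0∞) (s : S) : Set S :=
  if c ≤ reachValue (bellman G (supOver fun s => {g s})) X s then {g s} else C s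

theorem commit_of_le (hs : c ≤ reachValue (bellman G (supOver fun s => {g s})) X s) :
    commit G X C g c s = {g s} :=
  if_pos hs

theorem commit_of_lt (hs : reachValue (bellman G (supOver fun s => {g s})) X s < c) :
    commit G X C g c s = C s :=
  if_neg hs.not_ge

theorem mem_commit (hg : ∀ s, g s ∈ C s) (s : S) : g s ∈ commit G X C g c s := by
  unfold commit
  split_ifs
  exacts [rfl, hg s]

theorem commit_subset (hg : ∀ s, g s ∈ C s) (s : S) : commit G X C g c s ⊆ C s := by
  unfold commit
  split_ifs
  exacts [Set.singleton_subset_iff.2 (hg s), subset_rfl]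

theorem isAffine_bellman_singleton (g : S → S) :
    IsAffine (bellman G (supOver fun s => {g s})) :=
  isAffine_bellman (isAffine_supOver fun _ => Set.singleton_nonempty _)

/-- By continuity a near-optimal value survives a small discount `k`; then selecting successors
that are optimal up to a factor `l > k` costs less than the discount. -/
theorem exists_lt_reachValue_selection [DiscreteMeasurableSpace S]
    (hG : ∀ s, G.owner s = some .min → (G.succs s).Finite) (hC : ∀ s, (C s).Nonempty)
    {s₀ : S} (hc : c < reachValue (bellman G (supOver C)) X s₀) :
    ∃ g : S → S, (∀ s, g s ∈ C s) ∧ c < reachValue (bellman G (supOver fun s => {g s})) X s₀ := by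
  have hB := isAffine_bellman (G := G) (isAffine_supOver hC)
  obtain ⟨k, hk1, hk⟩ :=
    (isOmegaContinuous_bellman hG isOmegaContinuous_supOver).exists_lt_reachValue_discount hc
  obtain ⟨l, hkl, hl1⟩ := exists_between hk1
  set f := reachValue (discount k (bellman G (supOver C))) X
  have hf : f ≤ 1 := reachValue_le_one fun s => by
    rw [discount_apply, hB.map_one]
    exact mul_le_of_le_one_left' hk1.le
  choose g hgC hg using fun s => exists_mem_mul_supOver_le (hC s) hl1 hf
  refine ⟨g, hgC, hk.trans_le
    ((isAffine_bellman_singleton g).le_reachValue_of_le_discount (l := k / l) ?_ hf ?_ s₀)⟩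
  · exact ENNReal.div_lt_of_lt_mul (by rwa [one_mul])
  · intro s hs
    calc f s = k * bellman G (supOver C) f s := reachValue_of_notMem hs
      _ = k / l * (l * bellman G (supOver C) f s) := by
          rw [← mul_assoc, ENNReal.div_mul_cancel (bot_le.trans_lt hkl).ne' hl1.ne_top]
      _ ≤ k / l * bellman G (supOver fun s => {g s}) f s := by
          gcongr
          exact mul_bellman_le hl1.le ((hg s).trans (le_supOver (Set.mem_singleton _)))

/-- A commitment loses at most the factor `c` of the value, since `g` achieves `c` wherever it
matters; by the zero-one law, nothing is lost. -/
theorem isWinningRestriction_commit (hC : IsWinningRestriction G X C) (hg : ∀ s, g s ∈ C s)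
    (hc : c ≠ 0) (hc1 : c ≤ 1) : IsWinningRestriction G X (commit G X C g c) where
  nonempty s := ⟨g s, mem_commit hg s⟩
  reachValue_eq_one := by
    have hB := isAffine_bellman (G := G) (isAffine_supOver (C := commit G X C g c)
      fun s => ⟨g s, mem_commit hg s⟩)
    set u := reachValue (bellman G (supOver (commit G X C g c))) X
    have hctop := ne_top_of_le_ne_top ENNReal.one_ne_top hc1
    have hwu : reachValue (bellman G (supOver fun s => {g s})) X ≤ u :=
      reachValue_mono (bellman_mono (supOver_mono fun s =>
        Set.singleton_subset_iff.2 (mem_commit hg s)))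
    have h1u : reachValue (bellman G (supOver C)) X ≤ fun s => c⁻¹ * u s := by
      refine reachValue_le (fun s hs => ?_) fun s hs => ?_
      · simpa [u, reachValue_of_mem hs] using hc1
      rcases le_or_gt c (reachValue (bellman G (supOver fun s => {g s})) X s) with hcs | hcs
      · left
        rw [hC.reachValue_eq_one, Pi.one_apply, ← ENNReal.inv_mul_cancel hc hctop]
        gcongr
        exact hcs.trans (hwu s)
      · right
        calc bellman G (supOver C) (fun s => c⁻¹ * u s) s
            ≤ bellman G (supOver (commit G X C g c)) (fun s => c⁻¹ * u s) s :=
              bellman_le_bellman (supOver_le fun t ht =>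
                le_supOver (f := fun s => c⁻¹ * u s) ((commit_of_lt hcs).symm ▸ ht))
          _ = c⁻¹ * u s := by
              rw [hB.map_const_mul (ENNReal.inv_ne_zero.2 hctop) (ENNReal.inv_ne_top.2 hc),
                ← reachValue_of_notMem hs]
    refine hB.reachValue_eq_one hc fun s => ?_
    have h1s : 1 ≤ c⁻¹ * u s := by simpa [hC.reachValue_eq_one] using h1u s
    simpa [ENNReal.mul_inv_cancel_left hc hctop] using mul_le_mul_right h1s c

theorem reachValue_selection_le_infOver_commit (s : S) :
    reachValue (bellman G (supOver fun s => {g s})) X s ≤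
      c + reachValue (bellman G (infOver (commit G X C g c))) X s := by
  refine reachValue_le (f := fun s => c + reachValue (bellman G (infOver (commit G X C g c))) X s)
    (fun s hs => ?_) (fun s hs => ?_) s
  · simp [reachValue_of_mem hs]
  rcases le_or_gt c (reachValue (bellman G (supOver fun s => {g s})) X s) with hcs | hcs
  · right
    rw [(isAffine_bellman_singleton g).map_const_add, reachValue_of_notMem hs]
    gcongr
    refine bellman_le_bellman (supOver_le fun t ht => le_infOver fun t' ht' => ?_)
    rw [commit_of_le hcs] at ht'
    rw [Set.mem_singleton_iff.1 ht, Set.mem_singleton_iff.1 ht']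
  · exact .inl (hcs.le.trans le_self_add)

theorem IsWinningRestriction.exists_refinement [DiscreteMeasurableSpace S]
    (hC : IsWinningRestriction G X C) (hG : ∀ s, G.owner s = some .min → (G.succs s).Finite)
    (s₀ : S) :
    ∃ C', IsWinningRestriction G X C' ∧ (∀ s, C' s ⊆ C s) ∧ (C' s₀).Subsingleton ∧
      3⁻¹ ≤ reachValue (bellman G (infOver C')) X s₀ := by
  have h3 : (3⁻¹ : ℝ≥0∞) ≤ 1 := by simp
  have h23 : (3⁻¹ + 3⁻¹ : ℝ≥0∞) < 1 := by
    conv_rhs => rw [← ENNReal.inv_three_add_inv_three]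
    exact ENNReal.lt_add_right (by simp) (by simp)
  obtain ⟨g, hg, hgs⟩ := exists_lt_reachValue_selection hG hC.nonempty
    (h23.trans_eq (congrFun hC.reachValue_eq_one s₀).symm)
  refine ⟨commit G X C g 3⁻¹, isWinningRestriction_commit hC hg (by simp) h3, commit_subset hg,
    ?_, ?_⟩
  · rw [commit_of_le (le_self_add.trans hgs.le)]
    exact Set.subsingleton_singleton
  · exact (ENNReal.add_le_add_iff_left (by simp)).1
      (hgs.le.trans (reachValue_selection_le_infOver_commit s₀))

theorem IsWinningRestriction.exists_selection [Countable S] [DiscreteMeasurableSpace S]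
    (hC : IsWinningRestriction G X C) (hG : ∀ s, G.owner s = some .min → (G.succs s).Finite) :
    ∃ g : S → S, (∀ s, g s ∈ C s) ∧ reachValue (bellman G (supOver fun s => {g s})) X = 1 := by
  rcases isEmpty_or_nonempty S with _ | _
  · exact ⟨id, isEmptyElim, Subsingleton.elim _ _⟩
  obtain ⟨e, he⟩ := exists_surjective_nat S
  choose R hRwin hRsub hRsing hRval using
    fun (D : {D // IsWinningRestriction G X D}) s₀ => D.2.exists_refinement hG s₀
  let D : ℕ → {D // IsWinningRestriction G X D} :=
    Nat.rec ⟨C, hC⟩ fun n D => ⟨R D (e n), hRwin D (e n)⟩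
  have hDanti : ∀ s, Antitone fun n => (D n).1 s := fun s =>
    antitone_nat_of_succ_le fun n => hRsub (D n) (e n) s
  have hmem : ∀ s, ∃ t, ∀ n, t ∈ (D n).1 s := fun s => by
    obtain ⟨n, rfl⟩ := he s
    obtain ⟨t, ht⟩ := (D (n + 1)).2.nonempty (e n)
    refine ⟨t, fun m => ?_⟩
    rcases le_total m (n + 1) with hm | hm
    · exact hDanti _ hm ht
    · obtain ⟨t', ht'⟩ := (D m).2.nonempty (e n)
      rwa [hRsing (D n) (e n) ht (hDanti _ hm ht')]
  choose g hg using hmem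
  refine ⟨g, fun s => hg s 0, (isAffine_bellman_singleton g).reachValue_eq_one
    (c := 3⁻¹) (by simp) fun s => ?_⟩
  obtain ⟨n, rfl⟩ := he s
  exact (hRval (D n) (e n)).trans (reachValue_mono (bellman_mono fun f s =>
    (infOver_le (hg s (n + 1))).trans (le_supOver (Set.mem_singleton _))) _)

end Selection

section Plays

variable {S : Type*} {G : StochasticGame S} {s : S} {σ : G.Strategy .max} {π : G.Strategy .min}
  {w : List S}

/-- The strategy that is left of `τ` after the state `s` has been visited. -/
def Strategy.shift {p : Player} (τ : G.Strategy p) (s : S) : G.Strategy p where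
  move w := τ.move (s :: w)
  move_support w := τ.move_support (s :: w)

/-- The memoryless deterministic strategy of the player `p` that chooses the successor `f s` in
each state `s`. -/
noncomputable def mdStrategy (p : Player) (f : S → S) (hf : ∀ s, f s ∈ G.succs s) :
    G.Strategy p where
  move _ s _ := PMF.pure (f s)
  move_support _ s _ := (PMF.support_pure _).trans_subset (Set.singleton_subset_iff.2 (hf s))

theorem isMD_mdStrategy {p : Player} {f : S → S} (hf : ∀ s, f s ∈ G.succs s) :
    (mdStrategy p f hf).IsMD :=
  ⟨fun s _ => f s, fun _ _ _ => rfl⟩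

theorem step_max (h : G.owner s = some .max) : G.step σ π w s = σ.move w s h := by
  grind [step]

theorem step_min (h : G.owner s = some .min) : G.step σ π w s = π.move w s h := by
  grind [step]

theorem step_random (h : G.owner s = none) : G.step σ π w s = G.prob s h := by
  grind [step]

theorem step_shift {t : S} : G.step (σ.shift s) (π.shift s) w t = G.step σ π (s :: w) t := by
  unfold step Strategy.shift
  split <;> rfl

theorem support_step_subset : (G.step σ π w s).support ⊆ G.succs s := by
  unfold step
  split
  exacts [σ.move_support _ _ _, π.move_support _ _ _, G.prob_support _ _]

variable [MeasurableSpace S] [DiscreteMeasurableSpace S] {f : S → S} {hf : ∀ s, f s ∈ G.succs s}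
  {u : S → ℝ≥0∞}

theorem ae_step_mem_succs : ∀ᵐ t ∂(G.step σ π w s).toMeasure, t ∈ G.succs s := by
  rw [ae_iff, PMF.toMeasure_apply_eq_zero_iff _ .of_discrete]
  exact Set.disjoint_left.2 fun _ ht ht' => ht' (support_step_subset ht)

theorem bellman_le_lintegral_step :
    bellman G (supOver fun s => {f s}) u s ≤
      ∫⁻ t, u t ∂(G.step (mdStrategy .max f hf) π w s).toMeasure := by
  rcases hs : G.owner s with _ | _ | _
  · rw [bellman_random hs, step_random hs]
  · rw [bellman_max hs, step_max hs, mdStrategy, PMF.toMeasure_pure, lintegral_dirac]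
    exact supOver_le fun t ht => (congrArg u ht).le
  · rw [bellman_min hs]
    calc infOver G.succs u s
        = ∫⁻ _, infOver G.succs u s ∂(G.step (mdStrategy .max f hf) π w s).toMeasure := by simp
      _ ≤ ∫⁻ t, u t ∂(G.step (mdStrategy .max f hf) π w s).toMeasure :=
          lintegral_mono_ae (ae_step_mem_succs.mono fun _ ht => infOver_le ht)

theorem lintegral_step_le_bellman
    (hu : G.owner s = some .min → u (f s) ≤ infOver G.succs u s) :
    ∫⁻ t, u t ∂(G.step σ (mdStrategy .min f hf) w s).toMeasure ≤
      bellman G (supOver G.succs) u s := by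
  rcases hs : G.owner s with _ | _ | _
  · rw [bellman_random hs, step_random hs]
  · rw [bellman_max hs]
    calc ∫⁻ t, u t ∂(G.step σ (mdStrategy .min f hf) w s).toMeasure
        ≤ ∫⁻ _, supOver G.succs u s ∂(G.step σ (mdStrategy .min f hf) w s).toMeasure :=
          lintegral_mono_ae (ae_step_mem_succs.mono fun _ ht => le_supOver ht)
      _ = supOver G.succs u s := by simp
  · rw [bellman_min hs, step_min hs, mdStrategy, PMF.toMeasure_pure, lintegral_dirac]
    exact hu hs

end Plays

section FirstStep

variable {S : Type*}

/-- The play that starts in `s` and goes on as `x`. -/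
def consPlay (s : S) (x : ℕ → S) : ℕ → S
  | 0 => s
  | n + 1 => x n

theorem consPlay_preimage_cylinder_succ (a : ℕ → S) (n : ℕ) :
    consPlay (a 0) ⁻¹' PiNat.cylinder (E := fun _ => S) a (n + 1) =
      PiNat.cylinder (E := fun _ => S) (fun i => a (i + 1)) n := by
  ext x
  simp only [PiNat.cylinder, Set.mem_preimage, Set.mem_ofPred_eq, Nat.forall_lt_succ_left, consPlay,
    true_and]

theorem cylinder_succ_eq_preimage_frestrictLe (a : ℕ → S) (n : ℕ) :
    PiNat.cylinder (E := fun _ => S) a (n + 1) =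
      Preorder.frestrictLe (π := fun _ => S) n ⁻¹'
        {Preorder.frestrictLe (π := fun _ => S) n a} := by
  ext x
  simp [PiNat.cylinder, funext_iff]

variable [MeasurableSpace S]

@[fun_prop]
theorem measurable_consPlay (s : S) : Measurable (consPlay s) := by
  refine measurable_pi_lambda _ fun n => ?_
  cases n with
  | zero => exact measurable_const
  | succ n => exact measurable_pi_apply n

variable [DiscreteMeasurableSpace S] {a : ℕ → S} {n : ℕ}

theorem measurableSet_cylinder : MeasurableSet (PiNat.cylinder (E := fun _ => S) a n) := by
  simp only [PiNat.cylinder, Set.ofPred_forall]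
  exact .iInter fun i => .iInter fun _ =>
    (MeasurableSet.singleton (a i)).preimage (measurable_pi_apply i)

variable [Countable S]

theorem ext_of_cylinder {μ ν : Measure (ℕ → S)} [IsFiniteMeasure μ] [IsFiniteMeasure ν]
    (h : ∀ a n, μ (PiNat.cylinder (E := fun _ => S) a n) = ν (PiNat.cylinder a n)) : μ = ν := by
  let : TopologicalSpace S := ⊥
  have : DiscreteTopology S := ⟨rfl⟩
  refine ext_of_generate_finite _ (Pi.borelSpace.measurable_eq.trans
    (PiNat.isTopologicalBasis_cylinders fun _ => S).borel_eq_generateFrom) ?_ ?_ ?_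
  · rintro _ ⟨a, m, rfl⟩ _ ⟨b, n, rfl⟩ ⟨x, hxa, hxb⟩
    refine ⟨x, max m n, ?_⟩
    rw [← PiNat.mem_cylinder_iff_eq.1 hxa, ← PiNat.mem_cylinder_iff_eq.1 hxb]
    ext y
    simp only [PiNat.cylinder, Set.mem_inter_iff, Set.mem_ofPred_eq, lt_max_iff]
    exact ⟨fun hy i hi => hi.elim (hy.1 i) (hy.2 i),
      fun hy => ⟨fun i hi => hy i (.inl hi), fun i hi => hy i (.inr hi)⟩⟩
  · rintro _ ⟨a, n, rfl⟩
    exact h a n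
  · rcases isEmpty_or_nonempty (ℕ → S) with _ | ⟨⟨a⟩⟩
    · simp [Set.eq_empty_of_isEmpty]
    · simpa using h a 0

variable {G : StochasticGame S} {s : S} {σ : G.Strategy .max} {π : G.Strategy .min}

instance : IsProbabilityMeasure (G.playMeasure s σ π) := by
  unfold playMeasure
  infer_instance

theorem playMeasure_cylinder_one :
    G.playMeasure s σ π (PiNat.cylinder a 1) = ({a 0} : Set S).indicator 1 s := by
  rw [← zero_add 1, cylinder_succ_eq_preimage_frestrictLe,
    ← Measure.map_apply (Preorder.measurable_frestrictLe 0) (.singleton _), playMeasure,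
    Kernel.traj_map_frestrictLe_apply, Kernel.partialTraj_self, Kernel.id_apply,
    Measure.dirac_apply' _ (.singleton _)]
  refine Set.indicator_eq_indicator ?_ rfl
  simp [funext_iff]

theorem playMeasure_cylinder_add_two :
    G.playMeasure s σ π (PiNat.cylinder a (n + 2)) =
      G.playMeasure s σ π (PiNat.cylinder a (n + 1)) *
        G.step σ π (List.ofFn fun i : Fin n => a i) (a n) (a (n + 1)) := by
  have hstep := Kernel.partialTraj_compProd_eq_map_traj (κ := G.stepKernel σ π)
    (X := fun _ => S) (Nat.zero_le n) (x₀ := fun _ => s)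
  have hpre : PiNat.cylinder (E := fun _ => S) a (n + 2) = (fun x : ℕ → S =>
      (Preorder.frestrictLe (π := fun _ => S) n x, x (n + 1))) ⁻¹'
      ({Preorder.frestrictLe (π := fun _ => S) n a} ×ˢ {a (n + 1)}) := by
    rw [Set.mk_preimage_prod, ← cylinder_succ_eq_preimage_frestrictLe]
    ext x
    simp [PiNat.cylinder, Nat.forall_lt_succ_right (n := n + 1)]
  rw [playMeasure, hpre, ← Measure.map_apply (by fun_prop)
    ((MeasurableSet.singleton _).prod (.singleton _)), ← hstep,
    Measure.compProd_apply_prod (.singleton _) (.singleton _), lintegral_singleton,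
    ← Kernel.traj_map_frestrictLe_apply,
    Measure.map_apply (Preorder.measurable_frestrictLe n) (.singleton _),
    ← cylinder_succ_eq_preimage_frestrictLe, mul_comm]
  congr 1
  exact PMF.toMeasure_apply_singleton _ _ (.singleton _)

theorem playMeasure_cylinder_succ_of_eq (ha : a 0 = s) :
    G.playMeasure s σ π (PiNat.cylinder a (n + 1)) =
      ∫⁻ t, G.playMeasure t (σ.shift s) (π.shift s)
        (PiNat.cylinder (E := fun _ => S) (fun i => a (i + 1)) n) ∂(G.step σ π [] s).toMeasure := by
  induction n with
  | zero => simp [playMeasure_cylinder_one, ha]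
  | succ n ih =>
    rw [playMeasure_cylinder_add_two]
    cases n with
    | zero =>
      simp [playMeasure_cylinder_one, ha,
        PMF.toMeasure_apply_singleton _ _ (MeasurableSet.singleton _)]
    | succ n =>
      rw [ih, ← lintegral_mul_const _ .of_discrete]
      simp only [playMeasure_cylinder_add_two, step_shift, List.ofFn_succ, ← ha, Fin.val_succ,
        Fin.val_zero]

theorem playMeasure_eq_bind :
    G.playMeasure s σ π = (G.step σ π [] s).toMeasure.bind fun t =>
      (G.playMeasure t (σ.shift s) (π.shift s)).map (consPlay s) := by
  have hmeas : AEMeasurable (fun t => (G.playMeasure t (σ.shift s) (π.shift s)).map (consPlay s))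
      (G.step σ π [] s).toMeasure := Measurable.of_discrete.aemeasurable
  have : IsProbabilityMeasure ((G.step σ π [] s).toMeasure.bind fun t =>
      (G.playMeasure t (σ.shift s) (π.shift s)).map (consPlay s)) :=
    isProbabilityMeasure_bind hmeas (.of_forall fun t =>
      Measure.isProbabilityMeasure_map (measurable_consPlay s).aemeasurable)
  refine ext_of_cylinder fun a n => ?_
  rw [Measure.bind_apply measurableSet_cylinder hmeas]
  simp only [Measure.map_apply (measurable_consPlay s) measurableSet_cylinder]
  rcases n with _ | n
  · simp
  by_cases ha : a 0 = s
  · rw [playMeasure_cylinder_succ_of_eq ha, ← ha]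
    simp only [consPlay_preimage_cylinder_succ]
  · have hzero : G.playMeasure s σ π (PiNat.cylinder a (n + 1)) = 0 :=
      measure_mono_null (PiNat.cylinder_anti a (Nat.succ_le_succ n.zero_le))
        (by simp [playMeasure_cylinder_one, Ne.symm ha])
    have hempty : consPlay s ⁻¹' PiNat.cylinder (E := fun _ => S) a (n + 1) = ∅ :=
      Set.eq_empty_of_forall_notMem fun x hx => ha (hx 0 n.succ_pos).symm
    simp [hzero, hempty]

theorem playMeasure_apply {A : Set (ℕ → S)} (hA : MeasurableSet A) :
    G.playMeasure s σ π A = ∫⁻ t, G.playMeasure t (σ.shift s) (π.shift s) (consPlay s ⁻¹' A)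
      ∂(G.step σ π [] s).toMeasure := by
  rw [playMeasure_eq_bind, Measure.bind_apply hA Measurable.of_discrete.aemeasurable]
  simp only [Measure.map_apply (measurable_consPlay s) hA]

theorem ae_playMeasure_iff {p : (ℕ → S) → Prop} (hp : MeasurableSet {x | p x}) :
    (∀ᵐ x ∂G.playMeasure s σ π, p x) ↔ ∀ᵐ t ∂(G.step σ π [] s).toMeasure,
      ∀ᵐ x ∂G.playMeasure t (σ.shift s) (π.shift s), p (consPlay s x) := by
  rw [ae_iff, ← Set.compl_ofPred, playMeasure_apply hp.compl, lintegral_eq_zero_iff .of_discrete]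
  rfl

theorem ae_playMeasure_apply_zero : ∀ᵐ x ∂G.playMeasure s σ π, x 0 = s :=
  (ae_playMeasure_iff (measurableSet_eq_fun (measurable_pi_apply 0) measurable_const)).2
    (.of_forall fun _ => .of_forall fun _ => rfl)

end FirstStep

section Buchi

variable {S : Type*} {s : S} {X T : Set S}

theorem consPlay_mem_buchi {x : ℕ → S} : consPlay s x ∈ buchi T ↔ x ∈ buchi T := by
  constructor
  · intro h i
    obtain ⟨_ | j, hj, hjT⟩ := h (i + 1)
    exacts [absurd hj (by simp), ⟨j, Nat.succ_le_succ_iff.1 hj, hjT⟩]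
  · intro h i
    obtain ⟨j, hj, hjT⟩ := h i
    exact ⟨j + 1, hj.trans j.le_succ, hjT⟩

variable [MeasurableSpace S] [DiscreteMeasurableSpace S]

theorem measurable_apply_mem (n : ℕ) : Measurable fun x : ℕ → S => x n ∈ X :=
  Measurable.of_discrete.comp (measurable_pi_apply n)

theorem measurableSet_exists_apply_mem (p : ℕ → Prop) :
    MeasurableSet {x : ℕ → S | ∃ i, p i ∧ x i ∈ X} :=
  measurableSet_setOfPred.2 (.exists fun i => measurable_const.and (measurable_apply_mem i))

theorem measurableSet_buchi : MeasurableSet (buchi T) :=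
  measurableSet_setOfPred.2 (.forall fun i =>
    measurableSet_setOfPred.1 (measurableSet_exists_apply_mem (· ≥ i)))

variable [Countable S] {G : StochasticGame S} {f : S → S} {hf : ∀ s, f s ∈ G.succs s}
  {σ : G.Strategy .max} {π : G.Strategy .min} {W : Set S}

theorem ae_playMeasure_buchi_iff :
    (∀ᵐ x ∂G.playMeasure s σ π, x ∈ buchi T) ↔ ∀ᵐ t ∂(G.step σ π [] s).toMeasure,
      ∀ᵐ x ∂G.playMeasure t (σ.shift s) (π.shift s), x ∈ buchi T := by
  refine (ae_playMeasure_iff (p := (· ∈ buchi T)) measurableSet_buchi).trans ?_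
  simp only [consPlay_mem_buchi]

theorem reachValue_le_playMeasure :
    reachValue (bellman G (supOver fun s => {f s})) X s ≤
      G.playMeasure s (mdStrategy .max f hf) π {x | ∃ n, x n ∈ X} := by
  set R : Set (ℕ → S) := {x | ∃ n, x n ∈ X}
  have hRmeas : MeasurableSet R := measurableSet_setOfPred.2 (.exists measurable_apply_mem)
  have hle : reachValue (bellman G (supOver fun s => {f s})) X ≤
      fun s => ⨅ π, G.playMeasure s (mdStrategy .max f hf) π R := by
    refine reachValue_le (fun s hs => le_iInf fun π => ?_) fun s _ => .inr (le_iInf fun π => ?_)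
    · refine ((mem_ae_iff_prob_eq_one hRmeas).1 ?_).ge
      exact ae_playMeasure_apply_zero.mono fun x hx => ⟨0, hx ▸ hs⟩
    · calc bellman G (supOver fun s => {f s})
            (fun s => ⨅ π, G.playMeasure s (mdStrategy .max f hf) π R) s
          ≤ ∫⁻ t, ⨅ π, G.playMeasure t (mdStrategy .max f hf) π R
              ∂(G.step (mdStrategy .max f hf) π [] s).toMeasure := bellman_le_lintegral_step
        _ ≤ ∫⁻ t, G.playMeasure t (mdStrategy .max f hf) (π.shift s) (consPlay s ⁻¹' R)
              ∂(G.step (mdStrategy .max f hf) π [] s).toMeasure :=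
            lintegral_mono fun t => (iInf_le _ (π.shift s)).trans
              (measure_mono fun x ⟨n, hn⟩ => ⟨n + 1, hn⟩)
        _ = G.playMeasure s (mdStrategy .max f hf) π R := (playMeasure_apply hRmeas).symm
  exact (hle s).trans (iInf_le _ π)

theorem ae_exists_ge_mem (h : reachValue (bellman G (supOver fun s => {f s})) X = 1) (n : ℕ) :
    ∀ᵐ x ∂G.playMeasure s (mdStrategy .max f hf) π, ∃ j ≥ n, x j ∈ X := by
  induction n generalizing s π with
  | zero =>
    have h1 : 1 ≤ G.playMeasure s (mdStrategy .max f hf) π {x | ∃ n, x n ∈ X} :=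
      (congrFun h s).ge.trans reachValue_le_playMeasure
    have hmeas : MeasurableSet {x : ℕ → S | ∃ n, x n ∈ X} :=
      measurableSet_setOfPred.2 (.exists measurable_apply_mem)
    have hae := (mem_ae_iff_prob_eq_one hmeas).2 (prob_le_one.antisymm h1)
    exact Filter.mem_of_superset hae fun x ⟨j, hj⟩ => ⟨j, j.zero_le, hj⟩
  | succ n ih =>
    refine (ae_playMeasure_iff (measurableSet_exists_apply_mem _)).2 (.of_forall fun t => ?_)
    exact (ih (s := t) (π := π.shift s)).mono fun x ⟨j, hj, hjX⟩ =>
      ⟨j + 1, Nat.succ_le_succ hj, hjX⟩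

theorem ae_mem_buchi (h : reachValue (bellman G (supOver fun s => {f s})) X = 1) :
    ∀ᵐ x ∂G.playMeasure s (mdStrategy .max f hf) π, x ∈ buchi X :=
  ae_all_iff.2 (ae_exists_ge_mem h)

theorem ae_forall_mem (hW : ∀ w, ∀ s ∈ W, ∀ᵐ t ∂(G.step σ π w s).toMeasure, t ∈ W) (hs : s ∈ W) :
    ∀ᵐ x ∂G.playMeasure s σ π, ∀ n, x n ∈ W := by
  refine ae_all_iff.2 fun n => ?_
  induction n generalizing s σ π with
  | zero => exact ae_playMeasure_apply_zero.mono fun x hx => hx ▸ hs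
  | succ n ih =>
    refine (ae_playMeasure_iff (measurableSet_setOfPred.2 (measurable_apply_mem (n + 1)))).2
      ((hW [] s hs).mono fun t ht => ?_)
    exact ih (fun w r hr => by simpa only [step_shift] using hW (s :: w) r hr) ht

end Buchi

section Avoiding

variable {S : Type*} {B : (S → ℝ≥0∞) →o (S → ℝ≥0∞)} {f : S → ℝ≥0∞} {s t : S} {T L : Set S}
  {G : StochasticGame S}

/-- The transformer `B`, with the value `0` prescribed on `L`. -/
noncomputable def avoiding (L : Set S) (B : (S → ℝ≥0∞) →o (S → ℝ≥0∞)) :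
    (S → ℝ≥0∞) →o (S → ℝ≥0∞) where
  toFun f := Lᶜ.indicator (B f)
  monotone' _ _ hfg := fun s => Set.indicator_le_indicator (B.monotone hfg s)

theorem avoiding_of_mem (hs : s ∈ L) : avoiding L B f s = 0 :=
  Set.indicator_of_notMem (Set.notMem_compl_iff.2 hs) _

theorem avoiding_of_notMem (hs : s ∉ L) : avoiding L B f s = B f s :=
  Set.indicator_of_mem (Set.mem_compl hs) _

open Classical in
/-- The successors of `s` outside `L`, or all of them if there are none outside `L`. -/
def safeSuccs (G : StochasticGame S) (L : Set S) (s : S) : Set S :=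
  if (G.succs s \ L).Nonempty then G.succs s \ L else G.succs s

theorem safeSuccs_of_mem (ht : t ∈ G.succs s) (htL : t ∉ L) :
    G.safeSuccs L s = G.succs s \ L :=
  if_pos ⟨t, ht, htL⟩

theorem safeSuccs_subset : G.safeSuccs L s ⊆ G.succs s := by
  unfold safeSuccs
  split_ifs
  exacts [Set.sdiff_subset, subset_rfl]

theorem safeSuccs_nonempty : (G.safeSuccs L s).Nonempty := by
  unfold safeSuccs
  split_ifs with h
  exacts [h, G.succs_nonempty s]

theorem supOver_succs_le_supOver_safeSuccs (hf : ∀ t ∈ L, f t = 0) :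
    supOver G.succs f s ≤ supOver (G.safeSuccs L) f s := by
  refine supOver_le fun t ht => ?_
  by_cases htL : t ∈ L
  · simp [hf t htL]
  · exact le_supOver ((safeSuccs_of_mem ht htL).symm ▸ ⟨ht, htL⟩)

variable [MeasurableSpace S]

/-- The value of the game of reaching `T` without visiting `L` first. -/
noncomputable def avoidValue (G : StochasticGame S) (L T : Set S) : S → ℝ≥0∞ :=
  reachValue (avoiding L (bellman G (supOver G.succs))) (T \ L)

theorem avoidValue_of_mem (hs : s ∈ L) : avoidValue G L T s = 0 := by
  rw [avoidValue, reachValue_of_notMem fun h => h.2 hs, avoiding_of_mem hs]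

theorem avoidValue_of_mem_diff (hs : s ∈ T \ L) : avoidValue G L T s = 1 :=
  reachValue_of_mem hs

theorem avoidValue_of_notMem (hsL : s ∉ L) (hsT : s ∉ T) :
    avoidValue G L T s = bellman G (supOver G.succs) (avoidValue G L T) s := by
  conv_lhs => rw [avoidValue, reachValue_of_notMem fun h => hsT h.1, avoiding_of_notMem hsL]
  rfl

theorem avoidValue_eq_indicator
    (h : ∀ s ∉ L, 1 ≤ bellman G (supOver G.succs) (avoidValue G L T) s) :
    avoidValue G L T = Lᶜ.indicator 1 := by
  have hle : avoidValue G L T ≤ 1 := reachValue_le_one fun s =>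
    Set.indicator_le_self' (by simp) s |>.trans_eq
      (congrFun (isAffine_bellman (isAffine_supOver G.succs_nonempty)).map_one s)
  funext s
  by_cases hsL : s ∈ L
  · simp [avoidValue_of_mem, hsL]
  by_cases hsT : s ∈ T
  · simp [avoidValue_of_mem_diff ⟨hsT, hsL⟩, hsL]
  · simpa [hsL] using (hle s).antisymm ((h s hsL).trans_eq (avoidValue_of_notMem hsL hsT).symm)

theorem isWinningRestriction_safeSuccs
    (h : ∀ s ∉ L, 1 ≤ bellman G (supOver G.succs) (avoidValue G L T) s) :
    IsWinningRestriction G (T ∪ L) (G.safeSuccs L) where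
  nonempty _ := safeSuccs_nonempty
  reachValue_eq_one := by
    set v := reachValue (bellman G (supOver (G.safeSuccs L))) (T ∪ L)
    have huv : avoidValue G L T ≤ Lᶜ.indicator v := by
      refine reachValue_le (fun s hs => ?_) fun s hs => ?_
      · rw [Set.indicator_of_mem hs.2]
        exact (reachValue_of_mem (.inl hs.1)).ge
      by_cases hsL : s ∈ L
      · exact .inl ((avoidValue_of_mem hsL).trans_le bot_le)
      right
      rw [avoiding_of_notMem hsL, Set.indicator_of_mem hsL]
      calc bellman G (supOver G.succs) (Lᶜ.indicator v) s
          ≤ bellman G (supOver (G.safeSuccs L)) (Lᶜ.indicator v) s :=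
            bellman_le_bellman (supOver_succs_le_supOver_safeSuccs fun t ht =>
              Set.indicator_of_notMem (Set.notMem_compl_iff.2 ht) v)
        _ ≤ bellman G (supOver (G.safeSuccs L)) v s :=
            (bellman G _).monotone (Set.indicator_le_self' (by simp)) s
        _ = v s := (reachValue_of_notMem fun hs' => hs'.elim (fun hT => hs ⟨hT, hsL⟩) hsL).symm
    have hB := isAffine_bellman (G := G)
      (isAffine_supOver (C := G.safeSuccs L) fun _ => safeSuccs_nonempty)
    refine hB.reachValue_le_one.antisymm fun s => ?_
    by_cases hsL : s ∈ L
    · exact (reachValue_of_mem (.inr hsL)).ge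
    · simpa [avoidValue_eq_indicator h, hsL] using huv s

variable [DiscreteMeasurableSpace S] {g : S → S} {hg : ∀ s, g s ∈ G.succs s} {π : G.Strategy .min}

theorem ae_step_notMem (hgL : ∀ s, g s ∈ G.safeSuccs L s)
    (h : 1 ≤ bellman G (supOver G.succs) (Lᶜ.indicator 1) s) (w : List S) :
    ∀ᵐ t ∂(G.step (mdStrategy .max g hg) π w s).toMeasure, t ∈ Lᶜ := by
  refine (mem_ae_iff_prob_eq_one .of_discrete).2 (prob_le_one.antisymm ?_)
  calc 1 ≤ bellman G (supOver G.succs) (Lᶜ.indicator 1) s := h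
    _ ≤ bellman G (supOver fun s => {g s}) (Lᶜ.indicator 1) s := by
        refine bellman_le_bellman (supOver_le fun t ht => ?_)
        by_cases htL : t ∈ L
        · simp [htL]
        · have hgs : g s ∉ L := (safeSuccs_of_mem ht htL ▸ hgL s).2
          exact le_trans (by simp [htL, hgs]) (le_supOver (Set.mem_singleton (g s)))
    _ ≤ ∫⁻ t, Lᶜ.indicator 1 t ∂(G.step (mdStrategy .max g hg) π w s).toMeasure :=
        bellman_le_lintegral_step
    _ = (G.step (mdStrategy .max g hg) π w s).toMeasure Lᶜ := lintegral_indicator_one .of_discrete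

/-- The plays from a state outside `L` stay outside `L` and visit `T ∪ L` infinitely often. -/
theorem exists_ae_mem_buchi [Countable S] (hG : ∀ s, G.owner s = some .min → (G.succs s).Finite)
    (h : ∀ s ∉ L, 1 ≤ bellman G (supOver G.succs) (avoidValue G L T) s) :
    ∃ (g : S → S) (hg : ∀ s, g s ∈ G.succs s), ∀ s ∉ L, ∀ π : G.Strategy .min,
      ∀ᵐ x ∂G.playMeasure s (mdStrategy .max g hg) π, x ∈ buchi T := by
  obtain ⟨g, hgL, hg⟩ := (isWinningRestriction_safeSuccs h).exists_selection hG
  refine ⟨g, fun s => safeSuccs_subset (hgL s), fun s hs π => ?_⟩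
  rw [avoidValue_eq_indicator h] at h
  filter_upwards [ae_mem_buchi hg, ae_forall_mem (fun w r hr => ae_step_notMem hgL (h r hr) w) hs]
    with x hx hxL i
  obtain ⟨j, hj, hjT | hjL⟩ := hx i
  exacts [⟨j, hj, hjT⟩, absurd hjL (hxL j)]

end Avoiding

section Spoiling

variable {S : Type*} [Countable S] [MeasurableSpace S] [DiscreteMeasurableSpace S]
  {G : StochasticGame S} {s : S} {f : S → S} {hf : ∀ s, f s ∈ G.succs s} {σ : G.Strategy .max}
  {T L : Set S} {E : Set (S × S)}

theorem playMeasure_exists_lt_le_avoidValue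
    (hL : ∀ s ∈ L, ∀ σ, ¬ ∀ᵐ x ∂G.playMeasure s σ (mdStrategy .min f hf), x ∈ buchi T)
    (hmin : ∀ s ∉ L, bellman G (supOver G.succs) (avoidValue G L T) s < 1 →
      G.owner s = some .min → avoidValue G L T (f s) ≤ infOver G.succs (avoidValue G L T) s)
    (h : ∀ᵐ x ∂G.playMeasure s σ (mdStrategy .min f hf), x ∈ buchi T) (n : ℕ) :
    G.playMeasure s σ (mdStrategy .min f hf) {x | ∃ i < n, x i ∈ T} ≤ avoidValue G L T s := by
  induction n generalizing s σ with
  | zero => simp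
  | succ n ih =>
    have hsL : s ∉ L := fun hs => hL s hs σ h
    by_cases hsT : s ∈ T
    · exact prob_le_one.trans (avoidValue_of_mem_diff ⟨hsT, hsL⟩).ge
    rcases le_or_gt 1 (avoidValue G L T s) with h1 | h1
    · exact prob_le_one.trans h1
    have hpre : consPlay s ⁻¹' {x | ∃ i < n + 1, x i ∈ T} = {x | ∃ i < n, x i ∈ T} := by
      ext x
      simp only [Set.mem_preimage, Set.mem_ofPred_eq, Nat.exists_lt_succ_left, consPlay, hsT,
        false_or]
    rw [avoidValue_of_notMem hsL hsT] at h1 ⊢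
    rw [playMeasure_apply (measurableSet_exists_apply_mem _), hpre]
    exact (lintegral_mono_ae ((ae_playMeasure_buchi_iff.1 h).mono fun t ht => ih ht)).trans
      (lintegral_step_le_bellman (hmin s hsL h1))

theorem one_le_avoidValue
    (hL : ∀ s ∈ L, ∀ σ, ¬ ∀ᵐ x ∂G.playMeasure s σ (mdStrategy .min f hf), x ∈ buchi T)
    (hmin : ∀ s ∉ L, bellman G (supOver G.succs) (avoidValue G L T) s < 1 →
      G.owner s = some .min → avoidValue G L T (f s) ≤ infOver G.succs (avoidValue G L T) s)
    (h : ∀ᵐ x ∂G.playMeasure s σ (mdStrategy .min f hf), x ∈ buchi T) :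
    1 ≤ avoidValue G L T s := by
  have hmono : Monotone fun n => {x : ℕ → S | ∃ i < n, x i ∈ T} := fun m n hmn x ⟨i, hi, hiT⟩ =>
    ⟨i, hi.trans_le hmn, hiT⟩
  have hunion : ∀ᵐ x ∂G.playMeasure s σ (mdStrategy .min f hf),
      x ∈ ⋃ n, {x : ℕ → S | ∃ i < n, x i ∈ T} := h.mono fun x hx => by
    obtain ⟨j, -, hj⟩ := hx 0
    exact Set.mem_iUnion.2 ⟨j + 1, j, j.lt_succ_self, hj⟩
  calc 1 = G.playMeasure s σ (mdStrategy .min f hf) (⋃ n, {x | ∃ i < n, x i ∈ T}) :=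
        ((mem_ae_iff_prob_eq_one (.iUnion fun n => measurableSet_exists_apply_mem (· < n))).1
          hunion).symm
    _ = ⨆ n, G.playMeasure s σ (mdStrategy .min f hf) {x | ∃ i < n, x i ∈ T} :=
        hmono.measure_iUnion
    _ ≤ avoidValue G L T s :=
        iSup_le (playMeasure_exists_lt_le_avoidValue hL hmin h)

theorem not_ae_mem_buchi_of_bellman_lt_one
    (hL : ∀ s ∈ L, ∀ σ, ¬ ∀ᵐ x ∂G.playMeasure s σ (mdStrategy .min f hf), x ∈ buchi T)
    (hmin : ∀ s ∉ L, bellman G (supOver G.succs) (avoidValue G L T) s < 1 →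
      G.owner s = some .min → avoidValue G L T (f s) ≤ infOver G.succs (avoidValue G L T) s)
    (hsL : s ∉ L) (hs : bellman G (supOver G.succs) (avoidValue G L T) s < 1) :
    ¬ ∀ᵐ x ∂G.playMeasure s σ (mdStrategy .min f hf), x ∈ buchi T := fun h => hs.not_ge <|
  calc 1 = ∫⁻ _, 1 ∂(G.step σ (mdStrategy .min f hf) [] s).toMeasure := by simp
    _ ≤ ∫⁻ t, avoidValue G L T t ∂(G.step σ (mdStrategy .min f hf) [] s).toMeasure :=
        lintegral_mono_ae ((ae_playMeasure_buchi_iff.1 h).mono fun t ht =>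
          one_le_avoidValue hL hmin ht)
    _ ≤ bellman G (supOver G.succs) (avoidValue G L T) s :=
        lintegral_step_le_bellman (hmin s hsL hs)

/-- A set `E` of edges, the graph of a partial memoryless deterministic strategy of the minimizer,
is *spoiling* if each of its extensions to a strategy keeps the probability of `buchi T` below `1`
from all states in which `E` makes a choice. -/
structure IsSpoiling (G : StochasticGame S) (T : Set S) (E : Set (S × S)) : Prop where
  mem_succs : ∀ e ∈ E, e.2 ∈ G.succs e.1
  injOn_fst : E.InjOn Prod.fst
  spoils (f : S → S) (hf : ∀ s, f s ∈ G.succs s) (hfE : ∀ e ∈ E, f e.1 = e.2) :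
    ∀ s ∈ Prod.fst '' E, ∀ σ, ¬ ∀ᵐ x ∂G.playMeasure s σ (mdStrategy .min f hf), x ∈ buchi T

theorem IsSpoiling.exists_extension (hE : IsSpoiling G T E) :
    ∃ f : S → S, (∀ s, f s ∈ G.succs s) ∧ ∀ e ∈ E, f e.1 = e.2 := by
  have hex : ∀ s, ∃ t ∈ G.succs s, ∀ e ∈ E, e.1 = s → t = e.2 := fun s => by
    by_cases hs : ∃ e ∈ E, e.1 = s
    · obtain ⟨e, he, rfl⟩ := hs
      exact ⟨e.2, hE.mem_succs e he, fun e' he' h => by rw [hE.injOn_fst he' he h]⟩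
    · obtain ⟨t, ht⟩ := G.succs_nonempty s
      exact ⟨t, ht, fun e he h => (hs ⟨e, he, h⟩).elim⟩
  choose f hf hfE using hex
  exact ⟨f, hf, fun e he => hfE e.1 e he rfl⟩

theorem exists_maximal_isSpoiling (G : StochasticGame S) (T : Set S) :
    ∃ E, Maximal (IsSpoiling G T) E := by
  refine zorn_subset {E | IsSpoiling G T E} fun c hc hchain =>
    ⟨⋃₀ c, ?_, fun _ => Set.subset_sUnion_of_mem⟩
  refine ⟨fun e ⟨E, hEc, he⟩ => (hc hEc).mem_succs e he, ?_, ?_⟩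
  · rintro e ⟨E, hEc, he⟩ e' ⟨E', hEc', he'⟩ h
    rcases hchain.total hEc hEc' with hsub | hsub
    exacts [(hc hEc').injOn_fst (hsub he) he' h, (hc hEc).injOn_fst he (hsub he') h]
  · rintro f hf hfE _ ⟨e, ⟨E, hEc, he⟩, rfl⟩
    exact (hc hEc).spoils f hf (fun e he => hfE e ⟨E, hEc, he⟩) _ ⟨e, he, rfl⟩

theorem IsSpoiling.union (hE : IsSpoiling G T E) (hf : ∀ s, f s ∈ G.succs s)
    (hmin : ∀ s, G.owner s = some .min → avoidValue G (Prod.fst '' E) T (f s) ≤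
      infOver G.succs (avoidValue G (Prod.fst '' E) T) s) :
    IsSpoiling G T (E ∪ (fun s => (s, f s)) '' {s | s ∉ Prod.fst '' E ∧
      bellman G (supOver G.succs) (avoidValue G (Prod.fst '' E) T) s < 1}) where
  mem_succs := by
    rintro e (he | ⟨s, -, rfl⟩)
    exacts [hE.mem_succs e he, hf s]
  injOn_fst := by
    rintro e (he | ⟨s, hs, rfl⟩) e' (he' | ⟨s', hs', rfl⟩) h
    · exact hE.injOn_fst he he' h
    · exact absurd ⟨e, he, h⟩ hs'.1
    · exact absurd ⟨e', he', h.symm⟩ hs.1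
    · exact congrArg (fun s => (s, f s)) h
  spoils f' hf' hfE' := by
    have hL := hE.spoils f' hf' fun e he => hfE' e (.inl he)
    rintro _ ⟨e, he | ⟨s, hs, rfl⟩, rfl⟩ σ
    · exact hL _ ⟨e, he, rfl⟩ σ
    · refine not_ae_mem_buchi_of_bellman_lt_one hL (fun r hrL hr hrmin => ?_) hs.1 hs.2
      rw [hfE' (r, f r) (.inr ⟨r, ⟨hrL, hr⟩, rfl⟩)]
      exact hmin r hrmin

theorem exists_isSpoiling_saturated (hG : ∀ s, G.owner s = some .min → (G.succs s).Finite)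
    (T : Set S) : ∃ E, IsSpoiling G T E ∧ ∀ s ∉ Prod.fst '' E,
      1 ≤ bellman G (supOver G.succs) (avoidValue G (Prod.fst '' E) T) s := by
  obtain ⟨E, hE⟩ := exists_maximal_isSpoiling G T
  obtain ⟨f, hf, hmin⟩ := exists_le_infOver_succs hG (avoidValue G (Prod.fst '' E) T)
  refine ⟨E, hE.prop, fun s hs => not_lt.1 fun hlt => hs ?_⟩
  exact ⟨(s, f s), hE.le_of_ge (hE.prop.union hf hmin) Set.subset_union_left
    (.inr ⟨s, ⟨hs, hlt⟩, rfl⟩), rfl⟩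

theorem exists_isMD_win_or_spoil (hG : ∀ s, G.owner s = some .min → (G.succs s).Finite)
    (T : Set S) :
    ∃ (σ' : G.Strategy .max) (π' : G.Strategy .min), σ'.IsMD ∧ π'.IsMD ∧ ∀ s,
      (∀ π, G.playMeasure s σ' π (buchi T) = 1) ∨ ∀ σ, G.playMeasure s σ π' (buchi T) < 1 := by
  obtain ⟨E, hE, hsat⟩ := exists_isSpoiling_saturated hG T
  obtain ⟨f, hf, hwin⟩ := exists_ae_mem_buchi hG hsat
  obtain ⟨g, hg, hgE⟩ := hE.exists_extension
  refine ⟨mdStrategy .max f hf, mdStrategy .min g hg, isMD_mdStrategy hf, isMD_mdStrategy hg,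
    fun s => ?_⟩
  simp only [prob_le_one.lt_iff_ne, ← mem_ae_iff_prob_eq_one measurableSet_buchi, Ne]
  by_cases hs : s ∈ Prod.fst '' E
  exacts [.inr (hE.spoils g hg hgE s hs), .inl (hwin s hs)]

end Spoiling

end StochasticGame

theorem theorem6_general {S : Type*} [Countable S] [MeasurableSpace S] [DiscreteMeasurableSpace S]
    (G : StochasticGame S) (hG : ∀ s, G.owner s = some .min → {s' | G.trans s s'}.Finite)
    (T : Set S) :
    (∃ (σ' : G.Strategy .max) (π' : G.Strategy .min), σ'.IsMD ∧ π'.IsMD ∧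
      ∀ s : S,
        (∀ π : G.Strategy .min, G.playMeasure s σ' π (buchi T) = 1) ∨
        (∀ σ : G.Strategy .max, G.playMeasure s σ π' (buchi T) < 1)) ∧
    G.StronglyMDDetermined (buchi T) (· ≥ ·) 1 := by
  obtain ⟨σ', π', hσ', hπ', h⟩ := StochasticGame.exists_isMD_win_or_spoil hG T
  exact ⟨⟨σ', π', hσ', hπ', h⟩, fun s =>
    (h s).imp (fun hwin => ⟨σ', hσ', fun π => (hwin π).ge⟩)
      fun hspoil => ⟨π', hπ', fun σ => (hspoil σ).not_ge⟩⟩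

theorem theorem6 {S : Type*} [Countable S] [MeasurableSpace S] [DiscreteMeasurableSpace S]
    (G : StochasticGame S) (hG : G.FinitelyBranching) (T : Set S) :
    (∃ (σ' : G.Strategy .max) (π' : G.Strategy .min), σ'.IsMD ∧ π'.IsMD ∧
      ∀ s : S,
        (∀ π : G.Strategy .min, G.playMeasure s σ' π (buchi T) = 1) ∨
        (∀ σ : G.Strategy .max, G.playMeasure s σ π' (buchi T) < 1)) ∧
    G.StronglyMDDetermined (buchi T) (· ≥ ·) 1 :=
  theorem6_general G (fun s _ => hG s) T
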